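/- A continuous propositional logic is a non-empty set $\mathcal S$ (of formulae) with two unary operations $\neg,\tfrac12$ and one binary operation $\dot-$, subject to no laws. It is free if there is $\mathcal S_0\subseteq\mathcal S$ such that $\mathcal S$ is freely generated from $\mathcal S_0$ by $\neg,\tfrac12,\dot-$. A truth assignment is a map $v\colon\mathcal S\to[0,1]$ with $v(\neg\varphi)=1-v(\varphi)$, $v(\tfrac12\varphi)=v(\varphi)/2$ and $v(\varphi\mathbin{\dot-}\psi)=\max(v(\varphi)-v(\psi),0)$ for all $\varphi,\psi\in\mathcal S$; it is a model of $\varphi$ if $v(\varphi)=0$, and a model of $\Sigma\subseteq\mathcal S$ if it is a model of every element of $\Sigma$. Write $\Sigma\models\varphi$ if every model of $\Sigma$ is a model of $\varphi$. Write $\varphi\wedge\psi$ for $\varphi\mathbin{\dot-}(\varphi\mathbin{\dot-}\psi)$. The axiom schemes are, for all $\varphi,\psi,\rho\in\mathcal S$: (A1) $(\varphi\mathbin{\dot-}\psi)\mathbin{\dot-}\varphi$; (A2) $((\rho\mathbin{\dot-}\varphi)\mathbin{\dot-}(\rho\mathbin{\dot-}\psi))\mathbin{\dot-}(\psi\mathbin{\dot-}\varphi)$;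 (A3) $(\varphi\wedge\psi)\mathbin{\dot-}(\psi\wedge\varphi)$; (A4) $(\varphi\mathbin{\dot-}\psi)\mathbin{\dot-}(\neg\psi\mathbin{\dot-}\neg\varphi)$; (A5) $\tfrac12\varphi\mathbin{\dot-}(\varphi\mathbin{\dot-}\tfrac12\varphi)$; (A6) $(\varphi\mathbin{\dot-}\tfrac12\varphi)\mathbin{\dot-}\tfrac12\varphi$. Write $\Sigma\vdash\varphi$ if $\varphi$ can be obtained from elements of $\Sigma$ and instances of (A1)–(A6) by finitely many applications of Modus Ponens: from $\varphi$ and $\psi\mathbin{\dot-}\varphi$ infer $\psi$. Theorem. Let $\mathcal S$ be a free continuous propositional logic, $\Sigma\subseteq\mathcal S$ finite and $\varphi\in\mathcal S$. Then $\Sigma\models\varphi$ if and only if $\Sigma\vdash\varphi$. -/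

import Mathlib

/-- The signature of continuous propositional logics: a set `S` of formulae with unary operations
`neg`, `half` and a binary operation `φ ∸ ψ`, subject to no laws whatsoever. -/
class ContPropLogic (S : Type*) where
  neg : S → S
  half : S → S
  dotminus : S → S → S

namespace ContPropLogic

infixl:65 " ∸ " => ContPropLogic.dotminus

/-- `φ ∧ ψ` abbreviates `φ ∸ (φ ∸ ψ)`; its truth value is the minimum of the truth values. -/
def conj {S : Type*} [ContPropLogic S] (φ ψ : S) : S := φ ∸ (φ ∸ ψ)

/-- Terms (well-formed expressions) in the connectives over a set of atoms `A`. -/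
inductive Term (A : Type*) where
  | atom : A → Term A
  | neg : Term A → Term A
  | half : Term A → Term A
  | dotminus : Term A → Term A → Term A

/-- The element of `S` denoted by a term whose atoms are elements of `S₀ ⊆ S`. -/
def Term.eval {S : Type*} [ContPropLogic S] {S₀ : Set S} : Term S₀ → S
  | .atom P => P
  | .neg t => ContPropLogic.neg t.eval
  | .half t => ContPropLogic.half t.eval
  | .dotminus s t => s.eval ∸ t.eval

/-- `S` is freely generated from `S₀` by the connectives: every element of `S` is denoted by
exactly one term over `S₀`. -/
def IsFreeOver {S : Type*} [ContPropLogic S] (S₀ : Set S) : Prop :=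
  Function.Bijective (Term.eval : Term S₀ → S)

/-- `S` is free: it is freely generated from some subset. -/
def IsFree (S : Type*) [ContPropLogic S] : Prop :=
  ∃ S₀ : Set S, IsFreeOver S₀

/-- Truth assignments `v : S → [0,1]`. -/
structure TruthAssignment (S : Type*) [ContPropLogic S] where
  val : S → Set.Icc (0 : ℝ) 1
  val_neg : ∀ φ : S, (val (neg φ) : ℝ) = 1 - val φ
  val_half : ∀ φ : S, (val (half φ) : ℝ) = val φ / 2
  val_dotminus : ∀ φ ψ : S, (val (φ ∸ ψ) : ℝ) = max ((val φ : ℝ) - val ψ) 0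

/-- `v` is a model of `φ`: the value `0` means "true". -/
def TruthAssignment.Models {S : Type*} [ContPropLogic S] (v : TruthAssignment S) (φ : S) : Prop :=
  (v.val φ : ℝ) = 0

/-- `Γ ⊨ φ`: every model of all members of `Γ` is a model of `φ`. -/
def Entails {S : Type*} [ContPropLogic S] (Γ : Set S) (φ : S) : Prop :=
  ∀ v : TruthAssignment S, (∀ γ ∈ Γ, v.Models γ) → v.Models φ

/-- Instances of the six logical axiom schemes. -/
inductive IsAxiom {S : Type*} [ContPropLogic S] : S → Prop
  | a1 (φ ψ : S) : IsAxiom ((φ ∸ ψ) ∸ φ)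
  | a2 (φ ψ ρ : S) : IsAxiom (((ρ ∸ φ) ∸ (ρ ∸ ψ)) ∸ (ψ ∸ φ))
  | a3 (φ ψ : S) : IsAxiom (conj φ ψ ∸ conj ψ φ)
  | a4 (φ ψ : S) : IsAxiom ((φ ∸ ψ) ∸ (neg ψ ∸ neg φ))
  | a5 (φ : S) : IsAxiom (half φ ∸ (φ ∸ half φ))
  | a6 (φ : S) : IsAxiom ((φ ∸ half φ) ∸ half φ)

/-- `Γ ⊢ φ`: formal deducibility from premises in `Γ` and the logical axioms by Modus Ponens
(from `φ` and `ψ ∸ φ` infer `ψ`). -/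
inductive Derives {S : Type*} [ContPropLogic S] (Γ : Set S) : S → Prop
  | premise {φ : S} (h : φ ∈ Γ) : Derives Γ φ
  | logical {φ : S} (h : IsAxiom φ) : Derives Γ φ
  | mp {φ ψ : S} (h₁ : Derives Γ φ) (h₂ : Derives Γ (ψ ∸ φ)) : Derives Γ ψ

end ContPropLogic

/-! Soundness is an induction on derivations. For completeness, suppose `φ` is not derivable from
`Γ`. Zorn's lemma gives a theory containing `Γ` and maximal among those omitting `φ`. By (A1)–(A4)
its Lindenbaum algebra is an MV-algebra, and maximality makes it a chain: `α ∸ β` and `β ∸ α` have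
infimum zero, so if neither were in the theory, adjoining each would prove `φ`, and these two proofs
combine into one from the theory alone (`eq_zero_of_iterate_sub_eq_zero`).

By Chang's construction the chain is the unit interval of a linearly ordered abelian group. Via the
Hahn embedding, finitely many positive elements of such a group are positive under one additive map
to the reals. Since `Γ` is finite, only finitely many subformulae of `Γ` and `φ` matter; normalized
at `1`, such a map `g` preserves the order of their classes. Freeness allows giving the generators
their `g`-values, and (A5), (A6) make `g` respect halving. The resulting truth assignment models `Γ`
but not `φ`. -/

/-! ### MV-algebras. -/

/-- MV-algebras, presented by truncated subtraction as bounded commutative BCK-algebras. -/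
class MVAlgebra (A : Type*) extends Sub A, Zero A, One A where
  protected sub_right_comm : ∀ x y z : A, x - y - z = x - z - y
  protected sub_sub_comm : ∀ x y : A, x - (x - y) = y - (y - x)
  protected sub_self : ∀ x : A, x - x = 0
  protected sub_zero : ∀ x : A, x - 0 = x
  protected sub_one : ∀ x : A, x - 1 = 0

namespace MVAlgebra

section General

variable {A : Type*} [MVAlgebra A] {a b x y z : A}

protected theorem zero_sub (x : A) : 0 - x = 0 := by
  have h : (0 : A) - (0 - x) = 0 := by
    rw [← MVAlgebra.sub_sub_comm x 0, MVAlgebra.sub_zero, MVAlgebra.sub_self]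
  calc (0 : A) - x = 0 - (0 - x) - x := by rw [h]
    _ = 0 - x - (0 - x) := MVAlgebra.sub_right_comm _ _ _
    _ = 0 := MVAlgebra.sub_self _

/-- The left side without its last subtraction is `(z - y) - (z - x)`, by commutativity of the
infimum. Transitivity and both monotonicity laws follow from this. -/
theorem sub_sub_sub_sub (x y z : A) : x - y - (x - z) - (z - y) = 0 := by
  rw [MVAlgebra.sub_right_comm x y, MVAlgebra.sub_sub_comm x z, MVAlgebra.sub_right_comm z,
    MVAlgebra.sub_right_comm (z - y), MVAlgebra.sub_self, MVAlgebra.zero_sub]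

instance : PartialOrder A where
  le x y := x - y = 0
  le_refl := MVAlgebra.sub_self
  le_trans x y z hxy hyz := by
    have h := sub_sub_sub_sub x z y
    rwa [hxy, hyz, MVAlgebra.sub_zero, MVAlgebra.sub_zero] at h
  le_antisymm x y hxy hyx := by
    have h := MVAlgebra.sub_sub_comm x y
    rwa [hxy, hyx, MVAlgebra.sub_zero, MVAlgebra.sub_zero] at h

theorem le_iff_sub_eq_zero : x ≤ y ↔ x - y = 0 := Iff.rfl

protected theorem zero_le (x : A) : 0 ≤ x := MVAlgebra.zero_sub x

protected theorem le_one (x : A) : x ≤ 1 := MVAlgebra.sub_one x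

protected theorem le_zero_iff : x ≤ 0 ↔ x = 0 := by
  rw [le_iff_sub_eq_zero, MVAlgebra.sub_zero]

protected theorem sub_le_iff : x - y ≤ z ↔ x - z ≤ y := by
  rw [le_iff_sub_eq_zero, le_iff_sub_eq_zero, MVAlgebra.sub_right_comm]

protected theorem sub_le_self (x y : A) : x - y ≤ x := by
  rw [MVAlgebra.sub_le_iff, MVAlgebra.sub_self]
  exact MVAlgebra.zero_le y

protected theorem sub_le_sub_left (h : x ≤ y) (z : A) : z - y ≤ z - x := by
  have := sub_sub_sub_sub z y x
  rwa [le_iff_sub_eq_zero.1 h, MVAlgebra.sub_zero] at this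

protected theorem sub_le_sub_right (h : x ≤ y) (z : A) : x - z ≤ y - z := by
  have := sub_sub_sub_sub x z y
  rwa [le_iff_sub_eq_zero.1 h, MVAlgebra.sub_zero] at this

protected theorem sub_sub_cancel (h : y ≤ x) : x - (x - y) = y := by
  rw [MVAlgebra.sub_sub_comm, le_iff_sub_eq_zero.1 h, MVAlgebra.sub_zero]

theorem sub_sub_le_right (x y : A) : x - (x - y) ≤ y := by
  rw [MVAlgebra.sub_sub_comm]
  exact MVAlgebra.sub_le_self _ _

protected theorem le_sub_comm (hx : x ≤ z) (h : y ≤ z - x) : x ≤ z - y := by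
  rw [← MVAlgebra.sub_sub_cancel hx]
  exact MVAlgebra.sub_le_sub_left h z

/-- `x - (x - y)` is the infimum of `x` and `y`. -/
theorem le_sub_sub (hx : z ≤ x) (hy : z ≤ y) : z ≤ x - (x - y) :=
  MVAlgebra.le_sub_comm hx (MVAlgebra.sub_le_sub_left hy x)

theorem sub_sub_eq_sub_sub (ha : a ≤ x) (hb : b ≤ x) : b - (x - a) = a - (x - b) := by
  conv_lhs => rw [← MVAlgebra.sub_sub_cancel hb]
  rw [MVAlgebra.sub_right_comm, MVAlgebra.sub_sub_cancel ha]

theorem one_sub_sub_one_sub (x y : A) : 1 - x - (1 - y) = y - x := by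
  rw [MVAlgebra.sub_right_comm, MVAlgebra.sub_sub_cancel (MVAlgebra.le_one y)]

protected theorem sub_sub_sub_cancel_right (hzy : z ≤ y) (hyx : y ≤ x) :
    x - z - (y - z) = x - y := by
  have h : y - z = x - z - (x - y) := by
    conv_lhs => rw [← MVAlgebra.sub_sub_cancel hyx]
    exact MVAlgebra.sub_right_comm _ _ _
  rw [h, MVAlgebra.sub_sub_cancel (MVAlgebra.sub_le_sub_left hzy x)]

/-- Here `M` is the supremum of `1 - x` and `1 - y`. The hypotheses keep `M - z` above both, so `M ≤
M - z`, which forces `z = 0`. -/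
theorem eq_zero_of_le_sub_of_le_sub (h₁ : z ≤ x - y) (h₂ : z ≤ y - x) : z = 0 := by
  set M := 1 - (x - (x - y)) with hM
  have hM' : 1 - M = x - (x - y) := MVAlgebra.sub_sub_cancel (MVAlgebra.le_one _)
  have hx : 1 - x ≤ M := MVAlgebra.sub_le_sub_left (MVAlgebra.sub_le_self _ _) _
  have hy : 1 - y ≤ M := MVAlgebra.sub_le_sub_left (sub_sub_le_right _ _) _
  have hMx : M - (1 - x) = x - y := by
    rw [hM, one_sub_sub_one_sub, MVAlgebra.sub_sub_cancel (MVAlgebra.sub_le_self _ _)]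
  have hMy : M - (1 - y) = y - x := by
    rw [hM, one_sub_sub_one_sub, MVAlgebra.sub_sub_comm,
      MVAlgebra.sub_sub_cancel (MVAlgebra.sub_le_self _ _)]
  have hle : 1 - (M - z) ≤ x - (x - y) := by
    apply le_sub_sub
    · exact MVAlgebra.sub_le_iff.1
        (MVAlgebra.le_sub_comm hx (h₁.trans hMx.ge))
    · exact MVAlgebra.sub_le_iff.1
        (MVAlgebra.le_sub_comm hy (h₂.trans hMy.ge))
  have hMz : M ≤ M - z := by
    have := MVAlgebra.sub_le_iff.1 hle
    rwa [← hM] at this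
  have hz : z ≤ M :=
    h₁.trans (hMx.ge.trans (MVAlgebra.sub_le_self _ _))
  rw [← MVAlgebra.sub_sub_cancel hz]
  exact hMz

theorem iterate_sub_mono (a : A) (n : ℕ) (h : x ≤ y) : (· - a)^[n] x ≤ (· - a)^[n] y := by
  induction n generalizing x y with
  | zero => exact h
  | succ n ih => exact ih (MVAlgebra.sub_le_sub_right h a)

theorem iterate_sub_sub (a : A) (n : ℕ) (x y : A) :
    (· - a)^[n] (x - y) = (· - a)^[n] x - y := by
  induction n generalizing x with
  | zero => rfl
  | succ n ih =>
    simp only [Function.iterate_succ, Function.comp]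
    rw [MVAlgebra.sub_right_comm, ih]

theorem iterate_sub_eq_self (hab : ∀ z, z ≤ a → z ≤ b → z = 0) (hx : x ≤ a) (n : ℕ) :
    (· - b)^[n] x = x := by
  have h : x - b = x := by
    refine le_antisymm (MVAlgebra.sub_le_self _ _) ?_
    exact hab _ ((MVAlgebra.sub_le_self _ _).trans hx) (sub_sub_le_right x b)
  exact Function.iterate_fixed h n

/-- By induction `x - a = 0`, so `x ≤ a`; then `x` is disjoint from `b`, and subtracting `b` leaves
it unchanged. -/
theorem eq_zero_of_iterate_sub_eq_zero (hab : ∀ z, z ≤ a → z ≤ b → z = 0) {m n : ℕ}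
    (ha : (· - a)^[m] x = 0) (hb : (· - b)^[n] x = 0) : x = 0 := by
  induction m generalizing x with
  | zero => exact ha
  | succ m ih =>
    have hxa : x - a = 0 := by
      refine ih ha (MVAlgebra.le_zero_iff.1 ?_)
      exact (iterate_sub_mono b n (MVAlgebra.sub_le_self x a)).trans hb.le
    rwa [iterate_sub_eq_self hab hxa] at hb

end General

end MVAlgebra

/-! ### MV-chains and arithmetic modulo `1`. -/

/-- Nontrivial totally ordered MV-algebras. -/
class MVChain (L : Type*) extends MVAlgebra L where
  protected total : ∀ x y : L, x ≤ y ∨ y ≤ x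
  protected zero_ne_one : (0 : L) ≠ 1

namespace MVChain

open MVAlgebra

variable {L : Type*} [MVChain L] {a b c : L}

noncomputable instance : LinearOrder L where
  le_total := MVChain.total
  toDecidableLE := Classical.decRel _

protected theorem zero_lt_one : (0 : L) < 1 :=
  lt_of_le_of_ne (MVAlgebra.zero_le 1) MVChain.zero_ne_one

theorem one_sub_lt_one (h : a ≠ 0) : 1 - a < 1 := by
  refine lt_of_le_of_ne (MVAlgebra.le_one _) fun h' => h ?_
  rw [← MVAlgebra.sub_sub_cancel (MVAlgebra.le_one a), h', MVAlgebra.sub_self]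

theorem sub_ne_zero_of_lt (h : b < a) : a - b ≠ 0 := fun h' => h.not_ge h'

/-- Subtraction modulo `1`. -/
noncomputable def cyclicSub (c a : L) : L := if a ≤ c then c - a else 1 - (a - c)

/-- The integer borrowed when `a` is subtracted from `c` modulo `1`. -/
noncomputable def borrow (c a : L) : ℤ := if a ≤ c then 0 else 1

theorem cyclicSub_of_le (h : a ≤ c) : cyclicSub c a = c - a := if_pos h

theorem cyclicSub_of_lt (h : c < a) : cyclicSub c a = 1 - (a - c) := if_neg h.not_ge

theorem borrow_of_le (h : a ≤ c) : borrow c a = 0 := if_pos h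

theorem borrow_of_lt (h : c < a) : borrow c a = 1 := if_neg h.not_ge

theorem cyclicSub_lt_one (hc : c < 1) (a : L) : cyclicSub c a < 1 := by
  rcases le_or_gt a c with h | h
  · rw [cyclicSub_of_le h]
    exact (MVAlgebra.sub_le_self _ _).trans_lt hc
  · rw [cyclicSub_of_lt h]
    exact one_sub_lt_one (sub_ne_zero_of_lt h)

theorem one_sub_sub_sub (hac : a ≤ c) (hcb : c ≤ b) : 1 - (b - (c - a)) = 1 - (b - c) - a := by
  have hQ : b - (c - a) - a = b - c := by
    rw [MVAlgebra.sub_right_comm, MVAlgebra.sub_sub_sub_cancel_right hac hcb]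
  have haQ : a ≤ b - (c - a) := by
    conv_lhs => rw [← MVAlgebra.sub_sub_cancel hac]
    exact MVAlgebra.sub_le_sub_right hcb _
  have ha : a = b - (c - a) - (b - c) := by
    rw [← hQ, MVAlgebra.sub_sub_cancel haQ]
  conv_rhs => rw [ha]
  rw [MVAlgebra.sub_sub_sub_cancel_right
    (MVAlgebra.sub_le_sub_left (MVAlgebra.sub_le_self _ _) _) (MVAlgebra.le_one _)]

theorem cyclicSub_right_comm_aux (c a b : L) :
    cyclicSub (cyclicSub c a) b = cyclicSub (cyclicSub c b) a ∧
      borrow c a + borrow (cyclicSub c a) b = borrow c b + borrow (cyclicSub c b) a := by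
  -- The swap of `a` and `b` removes the case `b ≤ c < a`.
  wlog hab : (a ≤ c ∨ c < b) generalizing a b
  · push Not at hab
    have := this b a (.inl hab.2)
    exact ⟨this.1.symm, this.2.symm⟩
  rcases le_or_gt a c with ha | ha
  · rcases le_or_gt b c with hb | hb
    · rw [cyclicSub_of_le ha, cyclicSub_of_le hb, borrow_of_le ha, borrow_of_le hb]
      rcases le_or_gt b (c - a) with h | h
      · have h' : a ≤ c - b := MVAlgebra.le_sub_comm ha h
        rw [cyclicSub_of_le h, cyclicSub_of_le h', borrow_of_le h, borrow_of_le h']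
        exact ⟨MVAlgebra.sub_right_comm _ _ _, rfl⟩
      · have h' : c - b < a := lt_of_not_ge fun h' => h.not_ge (MVAlgebra.le_sub_comm hb h')
        rw [cyclicSub_of_lt h, cyclicSub_of_lt h', borrow_of_lt h, borrow_of_lt h',
          sub_sub_eq_sub_sub ha hb]
        exact ⟨rfl, rfl⟩
    · have h : c - a < b := (MVAlgebra.sub_le_self _ _).trans_lt hb
      have h' : a ≤ 1 - (b - c) := ha.trans
        (MVAlgebra.le_sub_comm (MVAlgebra.le_one c)
          (MVAlgebra.sub_le_sub_right (MVAlgebra.le_one b) c))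
      rw [cyclicSub_of_le ha, cyclicSub_of_lt hb, cyclicSub_of_lt h, cyclicSub_of_le h',
        borrow_of_le ha, borrow_of_lt hb, borrow_of_lt h, borrow_of_le h']
      exact ⟨one_sub_sub_sub ha hb.le, rfl⟩
  · have hb : c < b := hab.resolve_left ha.not_ge
    -- As `c < a` and `c < b`, both inequalities express `a + b ≤ 1 + c`.
    have key : ∀ {a b : L}, b ≤ 1 - (a - c) → a ≤ 1 - (b - c) := fun {a b} h => by
      have h₁ : a - c ≤ 1 - b := MVAlgebra.le_sub_comm (MVAlgebra.le_one _) h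
      rw [MVAlgebra.sub_le_iff,
        sub_sub_eq_sub_sub (MVAlgebra.le_one b) (MVAlgebra.le_one a), MVAlgebra.sub_le_iff] at h₁
      exact MVAlgebra.le_sub_comm (MVAlgebra.le_one _) h₁
    rw [cyclicSub_of_lt ha, cyclicSub_of_lt hb, borrow_of_lt ha, borrow_of_lt hb]
    rcases le_or_gt b (1 - (a - c)) with h | h
    · have h' := key h
      rw [cyclicSub_of_le h, cyclicSub_of_le h', borrow_of_le h, borrow_of_le h']
      refine ⟨?_, rfl⟩
      rw [MVAlgebra.sub_right_comm, MVAlgebra.sub_right_comm 1 (b - c),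
        ← one_sub_sub_one_sub c a, ← one_sub_sub_one_sub c b]
      exact sub_sub_eq_sub_sub (MVAlgebra.sub_le_sub_left ha.le 1)
        (MVAlgebra.sub_le_sub_left hb.le 1)
    · have h' : 1 - (b - c) < a := lt_of_not_ge fun h' => h.not_ge (key h')
      rw [cyclicSub_of_lt h, cyclicSub_of_lt h', borrow_of_lt h, borrow_of_lt h']
      refine ⟨?_, rfl⟩
      rw [sub_sub_eq_sub_sub (MVAlgebra.le_one (a - c)) (MVAlgebra.le_one b),
        sub_sub_eq_sub_sub (MVAlgebra.le_one (b - c)) (MVAlgebra.le_one a),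
        MVAlgebra.sub_right_comm a, MVAlgebra.sub_right_comm b,
        sub_sub_eq_sub_sub (MVAlgebra.le_one b) (MVAlgebra.le_one a)]

/-- The bound `a < 1` is essential: for `c < 1`, subtracting `1` cyclically from `c` gives `c`, and
subtracting again gives `0`. -/
theorem cyclicSub_cancel_aux (ha : a < 1) (c : L) :
    cyclicSub c (cyclicSub c a) = a ∧ borrow c (cyclicSub c a) = borrow c a := by
  rcases le_or_gt a c with h | h
  · have h' := MVAlgebra.sub_le_self c a
    rw [cyclicSub_of_le h, cyclicSub_of_le h', borrow_of_le h, borrow_of_le h']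
    exact ⟨MVAlgebra.sub_sub_cancel h, rfl⟩
  · have hc : 1 - c - (a - c) = 1 - a :=
      MVAlgebra.sub_sub_sub_cancel_right h.le (MVAlgebra.le_one a)
    have h' : c < 1 - (a - c) := by
      refine lt_of_not_ge fun h' => ha.not_ge ?_
      rw [MVAlgebra.sub_le_iff] at h'
      rw [le_iff_sub_eq_zero, ← hc]
      exact h'
    rw [cyclicSub_of_lt h, cyclicSub_of_lt h', borrow_of_lt h, borrow_of_lt h',
      MVAlgebra.sub_right_comm, hc, MVAlgebra.sub_sub_cancel (MVAlgebra.le_one a)]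
    exact ⟨rfl, rfl⟩

end MVChain

/-! ### Chang's linearly ordered group. -/

/-- An abelian group presented by its subtraction. -/
abbrev AddCommGroup.ofSub (X : Type*) [Sub X] [Zero X] (sub_self : ∀ x : X, x - x = 0)
    (sub_right_comm : ∀ x y z : X, x - y - z = x - z - y)
    (sub_sub_cancel : ∀ x y : X, x - (x - y) = y) : AddCommGroup X :=
  have sub_sub_sub (x y z : X) : x - y - (x - z) = z - y := by
    rw [sub_right_comm, sub_sub_cancel]
  have zero_sub_sub (x y : X) : 0 - (x - y) = y - x := by
    rw [← sub_self x, sub_sub_sub]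
  have sub_sub_swap (x y z : X) : x - (z - y) = y - (z - x) := by
    conv_lhs => rw [← sub_sub_cancel z x]
    exact sub_sub_sub _ _ _
  letI : Add X := ⟨fun x y => x - (0 - y)⟩
  letI : Neg X := ⟨fun x => 0 - x⟩
  { add_assoc := fun x y z => by
      change x - (0 - y) - (0 - z) = x - (0 - (y - (0 - z)))
      rw [zero_sub_sub, sub_right_comm, ← zero_sub_sub (0 - z) x, sub_sub_sub, sub_sub_swap]
    zero_add := fun x => sub_sub_cancel 0 x
    add_zero := fun x => by
      change x - (0 - 0) = x
      rw [sub_self, ← sub_self x, sub_sub_cancel]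
    nsmul := nsmulRec
    zsmul := zsmulRec
    neg_add_cancel := fun x => sub_self _
    add_comm := fun x y => sub_sub_swap x y 0
    sub_eq_add_neg := fun x y => by
      change x - y = x - (0 - (0 - y))
      rw [sub_sub_cancel] }

/-- Chang's group of a totally ordered MV-algebra: integers with a fractional part in the
algebra. -/
@[ext]
structure ChangGroup (L : Type*) [MVChain L] where
  int : ℤ
  frac : L
  frac_lt_one : frac < 1

namespace ChangGroup

open MVAlgebra MVChain

variable {L : Type*} [MVChain L]

instance : Zero (ChangGroup L) := ⟨⟨0, 0, MVChain.zero_lt_one⟩⟩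

noncomputable instance : Sub (ChangGroup L) where
  sub x y := ⟨x.int - y.int - borrow x.frac y.frac, cyclicSub x.frac y.frac,
    cyclicSub_lt_one x.frac_lt_one _⟩

theorem int_sub (x y : ChangGroup L) :
    (x - y).int = x.int - y.int - borrow x.frac y.frac := rfl

theorem frac_sub (x y : ChangGroup L) : (x - y).frac = cyclicSub x.frac y.frac := rfl

theorem int_zero : (0 : ChangGroup L).int = 0 := rfl

theorem frac_zero : (0 : ChangGroup L).frac = 0 := rfl

noncomputable instance : AddCommGroup (ChangGroup L) :=
  AddCommGroup.ofSub (ChangGroup L)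
    (fun x => by
      ext
      · rw [int_sub, borrow_of_le le_rfl, int_zero]
        lia
      · rw [frac_sub, cyclicSub_of_le le_rfl, MVAlgebra.sub_self, frac_zero])
    (fun x y z => by
      have h := cyclicSub_right_comm_aux x.frac y.frac z.frac
      ext
      · simp only [int_sub, frac_sub]
        linarith [h.2]
      · exact h.1)
    (fun x y => by
      have h := cyclicSub_cancel_aux y.frac_lt_one x.frac
      ext
      · simp only [int_sub, frac_sub]
        linarith [h.2]
      · exact h.1)

theorem int_neg (x : ChangGroup L) : (-x).int = - x.int - borrow 0 x.frac := by
  rw [← zero_sub x, int_sub, int_zero, frac_zero]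
  ring

theorem add_eq_sub_neg (x y : ChangGroup L) : x + y = x - (0 - y) := rfl

/-- The elements with nonnegative integer part. -/
def cone (L : Type*) [MVChain L] : AddGroupCone (ChangGroup L) where
  carrier := {x | 0 ≤ x.int}
  zero_mem' := by
    change (0 : ℤ) ≤ 0
    exact le_rfl
  add_mem' := by
    intro x y (hx : 0 ≤ x.int) (hy : 0 ≤ y.int)
    change 0 ≤ (x + y).int
    rw [add_eq_sub_neg, int_sub, int_sub, frac_sub, int_zero, frac_zero]
    rcases (MVAlgebra.zero_le y.frac).eq_or_lt with h | h
    · rw [← h, cyclicSub_of_le le_rfl, MVAlgebra.sub_self, borrow_of_le le_rfl,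
        borrow_of_le (MVAlgebra.zero_le _)]
      lia
    -- Negating `y` borrows `1`, which returns as a carry and pays for the possible second borrow.
    · rw [borrow_of_lt h]
      have : borrow x.frac (cyclicSub 0 y.frac) ≤ 1 := by
        unfold borrow
        split_ifs <;> lia
      lia
  eq_zero_of_mem_of_neg_mem' := by
    intro x (hx : 0 ≤ x.int) (hx' : 0 ≤ (-x).int)
    rw [int_neg] at hx'
    rcases (MVAlgebra.zero_le x.frac).eq_or_lt with h | h
    · rw [← h, borrow_of_le le_rfl] at hx'
      ext
      · rw [int_zero]
        lia
      · exact h.symm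
    · rw [borrow_of_lt h] at hx'
      lia

theorem mem_cone {x : ChangGroup L} : x ∈ cone L ↔ 0 ≤ x.int := by
  change x ∈ {x : ChangGroup L | 0 ≤ x.int} ↔ _
  rfl

instance : HasMemOrNegMem (cone L) where
  mem_or_neg_mem x := by
    rw [mem_cone, mem_cone, int_neg]
    have : borrow 0 x.frac ≤ 1 := by
      unfold borrow
      split_ifs <;> lia
    lia

noncomputable instance : LinearOrder (ChangGroup L) :=
  letI : DecidablePred (· ∈ cone L) := Classical.decPred _
  LinearOrder.mkOfAddGroupCone (cone L)

instance : IsOrderedAddMonoid (ChangGroup L) := IsOrderedAddMonoid.mkOfCone (cone L)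

theorem nonneg_iff {x : ChangGroup L} : 0 ≤ x ↔ 0 ≤ x.int := by
  change x - 0 ∈ cone L ↔ _
  rw [sub_zero, mem_cone]

open Classical in
/-- The embedding of an MV-chain as the unit interval of its Chang group. -/
noncomputable def of (a : L) : ChangGroup L :=
  if h : a < 1 then ⟨0, a, h⟩ else ⟨1, 0, MVChain.zero_lt_one⟩

theorem of_of_lt {a : L} (h : a < 1) : of a = ⟨0, a, h⟩ := dif_pos h

theorem of_one : of (1 : L) = ⟨1, 0, MVChain.zero_lt_one⟩ := dif_neg (lt_irrefl _)

theorem of_zero : of (0 : L) = 0 := of_of_lt MVChain.zero_lt_one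

theorem of_sub {a b : L} (h : b ≤ a) : of (a - b) = of a - of b := by
  rcases (MVAlgebra.le_one a).lt_or_eq with ha | rfl
  · rw [of_of_lt ha, of_of_lt (h.trans_lt ha),
      of_of_lt ((MVAlgebra.sub_le_self a b).trans_lt ha)]
    ext
    · simp [int_sub, borrow_of_le h]
    · simp [frac_sub, cyclicSub_of_le h]
  · rcases (MVAlgebra.le_one b).lt_or_eq with hb | rfl
    · rcases (MVAlgebra.zero_le b).eq_or_lt with rfl | hb'
      · rw [MVAlgebra.sub_zero, of_zero, sub_zero]
      · rw [of_of_lt hb, of_one, of_of_lt (one_sub_lt_one hb'.ne')]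
        ext
        · simp [int_sub, borrow_of_lt hb']
        · simp [frac_sub, cyclicSub_of_lt hb', MVAlgebra.sub_zero]
    · rw [MVAlgebra.sub_self, sub_self, of_zero]

theorem of_pos {a : L} (h : a ≠ 0) : 0 < of a := by
  refine lt_of_le_of_ne ?_ ?_
  · rw [nonneg_iff]
    unfold of
    split_ifs <;> simp
  · intro h'
    have h₁ := congrArg int h'
    have h₂ := congrArg frac h'
    unfold of at h₁ h₂
    split_ifs at h₁ h₂
    · exact h h₂.symm
    · simp [int_zero] at h₁

end ChangGroup

/-! ### Real-valued maps on ordered groups. -/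

section OrderedGroup

open Filter Topology

/-- With `i₀` below all exponents treated so far, take the `i₀`-coefficient plus `ε * f`. Small `ε`
keeps a positive `i₀`-coefficient dominant; series led by a later exponent have zero coefficient
there and inherit positivity from `f`. -/
theorem HahnSeries.exists_addMonoidHom_pos_of_leading {Ω : Type*} [LinearOrder Ω]
    {s : Set (HahnSeries Ω ℝ)} (hs : s.Finite) (E : Finset Ω) :
    ∃ f : HahnSeries Ω ℝ →+ ℝ,
      ∀ p ∈ s, ∀ i ∈ E, (∀ j < i, p.coeff j = 0) → 0 < p.coeff i → 0 < f p := by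
  induction E using Finset.induction_on_min with
  | empty => exact ⟨0, by simp⟩
  | insert i₀ E hE ih =>
    obtain ⟨f, hf⟩ := ih
    let c : HahnSeries Ω ℝ →+ ℝ := HahnSeries.coeff.addMonoidHom i₀
    have hc (p : HahnSeries Ω ℝ) : c p = p.coeff i₀ := rfl
    have hε : ∀ᶠ ε : ℝ in 𝓝[>] 0, ∀ p ∈ s, 0 < p.coeff i₀ → 0 < p.coeff i₀ + ε * f p := by
      refine (eventually_all_finite hs).2 fun p _ => ?_
      by_cases hp : 0 < p.coeff i₀
      · have hlim : Tendsto (fun ε : ℝ => p.coeff i₀ + ε * f p) (𝓝[>] 0) (𝓝 (p.coeff i₀)) := by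
          have : Continuous fun ε : ℝ => p.coeff i₀ + ε * f p := by fun_prop
          have h := this.tendsto 0
          rw [zero_mul, add_zero] at h
          exact h.mono_left nhdsWithin_le_nhds
        filter_upwards [hlim.eventually (lt_mem_nhds hp)] with ε h _ using h
      · exact Eventually.of_forall fun _ h => absurd h hp
    obtain ⟨ε, hε, hε₀ : 0 < ε⟩ := (hε.and self_mem_nhdsWithin).exists
    refine ⟨c + (AddMonoidHom.mulLeft ε).comp f, fun p hp i hi hlt hpos => ?_⟩
    change 0 < p.coeff i₀ + ε * f p
    rcases Finset.mem_insert.1 hi with rfl | hi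
    · exact hε p hp hpos
    · rw [hlt i₀ (hE i hi), zero_add]
      exact mul_pos hε₀ (hf p hp i hi hlt hpos)

/-- Finitely many positive elements of a linearly ordered abelian group are simultaneously positive
under some real-valued additive map. -/
theorem exists_addMonoidHom_real_pos {G : Type*} [AddCommGroup G] [LinearOrder G]
    [IsOrderedAddMonoid G] {s : Set G} (hs : s.Finite) (hpos : ∀ p ∈ s, 0 < p) :
    ∃ f : G →+ ℝ, ∀ p ∈ s, 0 < f p := by
  obtain ⟨e, he, -⟩ := hahnEmbedding_isOrderedAddMonoid G
  have hlead : ∀ p ∈ s, ∃ i, (∀ j < i, (ofLex (e p)).coeff j = 0) ∧ 0 < (ofLex (e p)).coeff i := by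
    intro p hp
    have h : e 0 < e p := ((OrderHomClass.monotone e).strictMono_of_injective he) (hpos p hp)
    rw [map_zero, HahnSeries.lt_iff] at h
    obtain ⟨i, h₁, h₂⟩ := h
    exact ⟨i, fun j hj => (h₁ j hj).symm, h₂⟩
  choose i hi using hlead
  have := hs.to_subtype
  obtain ⟨f, hf⟩ := HahnSeries.exists_addMonoidHom_pos_of_leading
    (hs.image fun p => ofLex (e p)) (Set.finite_range fun p : s => i p p.2).toFinset
  refine ⟨f.comp ⟨⟨fun p => ofLex (e p), by simp⟩, fun x y => by simp⟩, fun p hp => ?_⟩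
  exact hf _ (Set.mem_image_of_mem _ hp) (i p hp)
    ((Set.Finite.mem_toFinset _).2 ⟨⟨p, hp⟩, rfl⟩) (hi p hp).1 (hi p hp).2

/-- Finiteness of `F` matters: on a chain with infinitesimals no such `g` is positive on all nonzero
elements. Adding `1` to `F` permits the normalization. -/
theorem MVChain.exists_real_valuation {L : Type*} [MVChain L] {F : Set L} (hF : F.Finite) :
    ∃ g : L → ℝ, g 0 = 0 ∧ g 1 = 1 ∧ (∀ a b, b ≤ a → g (a - b) = g a - g b) ∧
      ∀ a ∈ F, a ≠ 0 → 0 < g a := by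
  obtain ⟨f, hf⟩ := exists_addMonoidHom_real_pos
    (s := ChangGroup.of '' (insert 1 F \ {0})) (((hF.insert 1).sdiff).image _) (by
      rintro _ ⟨a, ⟨-, ha⟩, rfl⟩
      exact ChangGroup.of_pos ha)
  have hu : 0 < f (ChangGroup.of 1) :=
    hf _ ⟨1, ⟨.inl rfl, MVChain.zero_ne_one.symm⟩, rfl⟩
  refine ⟨fun a => f (ChangGroup.of a) / f (ChangGroup.of 1), ?_, ?_, ?_, ?_⟩
  · simp [ChangGroup.of_zero]
  · exact div_self hu.ne'
  · intro a b h
    simp only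
    rw [ChangGroup.of_sub h, map_sub, sub_div]
  · intro a ha h
    exact div_pos (hf _ ⟨a, ⟨.inr ha, h⟩, rfl⟩) hu

end OrderedGroup

/-! ### Theories and their Lindenbaum algebras. -/

namespace ContPropLogic

variable {S : Type*} [ContPropLogic S]

/-- Sets of formulae containing the logical axioms and closed under Modus Ponens. -/
structure Theory (S : Type*) [ContPropLogic S] where
  carrier : Set S
  logical : ∀ {φ : S}, IsAxiom φ → φ ∈ carrier
  mp : ∀ {φ ψ : S}, φ ∈ carrier → ψ ∸ φ ∈ carrier → ψ ∈ carrier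

namespace Theory

/-- The theory of all formulae derivable from `Γ`. -/
def deductiveClosure (Γ : Set S) : Theory S where
  carrier := {φ | Derives Γ φ}
  logical h := .logical h
  mp h₁ h₂ := .mp h₁ h₂

variable (T : Theory S)

/-- Provable inequality of formulae. -/
def Le (φ ψ : S) : Prop := φ ∸ ψ ∈ T.carrier

variable {T} {φ ψ ρ τ : S}

theorem Le.mem (h : T.Le φ ψ) (hψ : ψ ∈ T.carrier) : φ ∈ T.carrier := T.mp hψ h

theorem Le.trans (h₁ : T.Le φ ψ) (h₂ : T.Le ψ ρ) : T.Le φ ρ :=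
  T.mp h₁ (T.mp h₂ (T.logical (.a2 ρ ψ φ)))

theorem dotminus_le (φ ψ : S) : T.Le (φ ∸ ψ) φ := T.logical (.a1 φ ψ)

theorem dotminus_dotminus_le (φ ψ : S) : T.Le (φ ∸ (φ ∸ ψ)) ψ :=
  Le.trans (T.logical (.a3 φ ψ)) (dotminus_le _ _)

theorem Le.dotminus_left (h : T.Le φ ψ) (ρ : S) : T.Le (ρ ∸ ψ) (ρ ∸ φ) :=
  T.mp h (T.logical (.a2 ψ φ ρ))

/-- Since `φ ∸ (φ ∸ ρ)` is below `ρ`, the left side is below `(φ ∸ ψ) ∸ (φ ∸ (φ ∸ ρ))`, and (A2)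
applies. -/
theorem dotminus_right_comm (φ ψ ρ : S) : T.Le (φ ∸ ψ ∸ ρ) (φ ∸ ρ ∸ ψ) :=
  ((dotminus_dotminus_le φ ρ).dotminus_left _).trans (T.logical (.a2 ψ (φ ∸ ρ) φ))

theorem Le.swap (h : T.Le (φ ∸ ψ) ρ) : T.Le (φ ∸ ρ) ψ := (dotminus_right_comm _ _ _).mem h

/-- Swapping in (A1) puts `φ ∸ φ` below `φ ∸ φ ∸ φ`, itself an instance of (A1). -/
theorem le_refl (φ : S) : T.Le φ φ :=
  (dotminus_le φ (φ ∸ φ ∸ φ)).swap.mem (T.logical (.a1 φ φ))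

theorem Le.dotminus_right (h : T.Le φ ψ) (ρ : S) : T.Le (φ ∸ ρ) (ψ ∸ ρ) :=
  Le.mem (Le.swap (T.logical (.a2 ρ ψ φ))) h

theorem le_dotminus_of_mem (hτ : τ ∈ T.carrier) (φ : S) : T.Le φ (φ ∸ τ) :=
  (dotminus_dotminus_le φ τ).mem hτ

theorem le_of_mem (hφ : φ ∈ T.carrier) (ψ : S) : T.Le φ ψ := (dotminus_le φ ψ).mem hφ

theorem contrapose (φ ψ : S) : T.Le (φ ∸ ψ) (neg ψ ∸ neg φ) := T.logical (.a4 φ ψ)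

theorem dotminus_le_neg (φ ψ : S) : T.Le (φ ∸ ψ) (neg ψ) :=
  (contrapose φ ψ).trans (dotminus_le _ _)

theorem le_neg_of_mem (hτ : τ ∈ T.carrier) (φ : S) : T.Le φ (neg τ) :=
  (dotminus_le_neg φ τ).swap.mem hτ

theorem le_neg_neg (φ : S) : T.Le φ (neg (neg φ)) :=
  have hτ : φ ∸ φ ∈ T.carrier := le_refl φ
  ((le_dotminus_of_mem hτ φ).trans (contrapose _ _)).trans (dotminus_le_neg _ _)

theorem neg_le_neg_dotminus (hτ : τ ∈ T.carrier) (φ : S) : T.Le (neg φ) (neg τ ∸ φ) :=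
  ((le_dotminus_of_mem hτ _).trans (contrapose _ _)).trans ((le_neg_neg φ).dotminus_left _)

variable (T)

/-- Provable equivalence of formulae. -/
def setoid : Setoid S where
  r φ ψ := T.Le φ ψ ∧ T.Le ψ φ
  iseqv :=
    { refl := fun φ => ⟨le_refl φ, le_refl φ⟩
      symm := And.symm
      trans := fun h₁ h₂ => ⟨h₁.1.trans h₂.1, h₂.2.trans h₁.2⟩ }

/-- The Lindenbaum algebra of a theory. -/
def Lindenbaum : Type _ := Quotient T.setoid

/-- The class of a formula in the Lindenbaum algebra. -/
def toLindenbaum (φ : S) : T.Lindenbaum := Quotient.mk T.setoid φ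

variable {T}

theorem toLindenbaum_eq_iff : T.toLindenbaum φ = T.toLindenbaum ψ ↔ T.Le φ ψ ∧ T.Le ψ φ :=
  Quotient.eq (r := T.setoid)

theorem exists_maximal (T : Theory S) (hφ : φ ∉ T.carrier) :
    ∃ T' : Theory S, T.carrier ⊆ T'.carrier ∧
      Maximal (fun A : Set S => ∃ T' : Theory S, T'.carrier = A ∧ φ ∉ A) T'.carrier := by
  obtain ⟨A, hTA, hA⟩ := zorn_subset_nonempty
    {A : Set S | ∃ T' : Theory S, T'.carrier = A ∧ φ ∉ A} (fun c hc hchain hne => by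
      refine ⟨⋃₀ c, ⟨⟨⋃₀ c, fun h => ?_, fun h₁ h₂ => ?_⟩, rfl, ?_⟩,
        fun s hs => Set.subset_sUnion_of_mem hs⟩
      · obtain ⟨A, hA⟩ := hne
        obtain ⟨T', rfl, -⟩ := hc hA
        exact ⟨_, hA, T'.logical h⟩
      · obtain ⟨A, hA, h₁⟩ := h₁
        obtain ⟨B, hB, h₂⟩ := h₂
        obtain ⟨C, hC, hAC, hBC⟩ := hchain.directedOn A hA B hB
        obtain ⟨T', rfl, -⟩ := hc hC
        exact ⟨_, hC, T'.mp (hAC h₁) (hBC h₂)⟩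
      · rintro ⟨A, hA, hφA⟩
        obtain ⟨-, -, h⟩ := hc hA
        exact h hφA) T.carrier ⟨T, rfl, hφ⟩
  obtain ⟨T', rfl, hφ'⟩ := hA.1
  exact ⟨T', hTA, hA⟩

variable [Nonempty S]

/-- A formula with value `0`. -/
noncomputable def verum : S := Classical.arbitrary S ∸ Classical.arbitrary S

theorem verum_mem : (verum : S) ∈ T.carrier := le_refl _

noncomputable instance : MVAlgebra T.Lindenbaum where
  sub := Quotient.map₂ dotminus fun _ _ h₁ _ _ h₂ =>
    ⟨(h₁.1.dotminus_right _).trans (h₂.2.dotminus_left _),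
      (h₁.2.dotminus_right _).trans (h₂.1.dotminus_left _)⟩
  zero := T.toLindenbaum verum
  one := T.toLindenbaum (neg verum)
  sub_right_comm := by
    rintro ⟨φ⟩ ⟨ψ⟩ ⟨ρ⟩
    exact toLindenbaum_eq_iff.2 ⟨dotminus_right_comm _ _ _, dotminus_right_comm _ _ _⟩
  sub_sub_comm := by
    rintro ⟨φ⟩ ⟨ψ⟩
    exact toLindenbaum_eq_iff.2 ⟨T.logical (.a3 φ ψ), T.logical (.a3 ψ φ)⟩
  sub_self := by
    rintro ⟨φ⟩
    exact toLindenbaum_eq_iff.2 ⟨le_of_mem (le_refl φ) _, le_of_mem verum_mem _⟩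
  sub_zero := by
    rintro ⟨φ⟩
    exact toLindenbaum_eq_iff.2 ⟨dotminus_le _ _, le_dotminus_of_mem verum_mem _⟩
  sub_one := by
    rintro ⟨φ⟩
    exact toLindenbaum_eq_iff.2 ⟨le_of_mem (le_neg_of_mem verum_mem φ) _, le_of_mem verum_mem _⟩

theorem toLindenbaum_dotminus (φ ψ : S) :
    T.toLindenbaum (φ ∸ ψ) = T.toLindenbaum φ - T.toLindenbaum ψ := rfl

theorem toLindenbaum_eq_zero : T.toLindenbaum φ = 0 ↔ φ ∈ T.carrier :=
  toLindenbaum_eq_iff.trans ⟨fun h => h.1.mem verum_mem,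
    fun h => ⟨le_of_mem h _, le_of_mem verum_mem _⟩⟩

theorem toLindenbaum_neg (φ : S) : T.toLindenbaum (neg φ) = 1 - T.toLindenbaum φ :=
  toLindenbaum_eq_iff.2 ⟨neg_le_neg_dotminus verum_mem φ, dotminus_le_neg _ _⟩

theorem toLindenbaum_sub_half (φ : S) : T.toLindenbaum φ - T.toLindenbaum (half φ) =
    T.toLindenbaum (half φ) :=
  toLindenbaum_eq_iff.2 ⟨T.logical (.a6 φ), T.logical (.a5 φ)⟩

variable (T) in
/-- The theory generated by adjoining a formula. -/
def adjoin (α : S) : Theory S where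
  -- This is the deduction theorem in algebraic form: a proof may use `α` several times, hence the
  -- iteration.
  carrier := {φ | ∃ n : ℕ, (· - T.toLindenbaum α)^[n] (T.toLindenbaum φ) = 0}
  logical h := ⟨0, toLindenbaum_eq_zero.2 (T.logical h)⟩
  mp := by
    rintro φ ψ ⟨n, hn⟩ ⟨m, hm⟩
    refine ⟨n + m, MVAlgebra.le_zero_iff.1 ?_⟩
    rw [toLindenbaum_dotminus, MVAlgebra.iterate_sub_sub] at hm
    rw [Function.iterate_add_apply, ← hn]
    exact MVAlgebra.iterate_sub_mono _ _ hm

theorem subset_adjoin (α : S) : T.carrier ⊆ (T.adjoin α).carrier :=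
  fun _ h => ⟨0, toLindenbaum_eq_zero.2 h⟩

theorem mem_adjoin_self (α : S) : α ∈ (T.adjoin α).carrier :=
  ⟨1, MVAlgebra.sub_self _⟩

/-- Maximal theories omitting a formula are prime. -/
theorem total_of_maximal (h : Maximal (fun A : Set S => ∃ T' : Theory S, T'.carrier = A ∧ φ ∉ A)
    T.carrier) (α β : S) : T.Le α β ∨ T.Le β α := by
  -- By maximality, adjoining any formula outside the theory makes `φ` provable.
  have hmem : ∀ γ, γ ∉ T.carrier → φ ∈ (T.adjoin γ).carrier := fun γ hγ => by
    by_contra hφ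
    exact hγ (h.2 ⟨_, rfl, hφ⟩ (subset_adjoin γ) (mem_adjoin_self γ))
  by_contra! hne
  obtain ⟨m, hm⟩ := hmem _ hne.1
  obtain ⟨n, hn⟩ := hmem _ hne.2
  rw [toLindenbaum_dotminus] at hm hn
  obtain ⟨-, -, hφ⟩ := h.1
  exact hφ (toLindenbaum_eq_zero.1 (MVAlgebra.eq_zero_of_iterate_sub_eq_zero
    (fun z h₁ h₂ => MVAlgebra.eq_zero_of_le_sub_of_le_sub h₁ h₂) hm hn))

/-- The Lindenbaum algebra of a prime consistent theory as an MV-chain. -/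
@[reducible]
noncomputable def mvChain (htotal : ∀ α β : S, T.Le α β ∨ T.Le β α) (hφ : φ ∉ T.carrier) :
    MVChain T.Lindenbaum where
  total := by
    rintro ⟨α⟩ ⟨β⟩
    exact (htotal α β).imp toLindenbaum_eq_zero.2 toLindenbaum_eq_zero.2
  zero_ne_one h := hφ <|
    (toLindenbaum_eq_zero.1 (MVAlgebra.le_zero_iff.1 (h ▸ MVAlgebra.le_one (T.toLindenbaum φ))))

end Theory

/-! ### Terms and truth assignments on a free logic. -/

namespace Term

variable {A : Type*}

/-- The set of subterms of a term. -/
def subterms : Term A → Set (Term A)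
  | .atom a => {.atom a}
  | .neg t => insert (.neg t) t.subterms
  | .half t => insert (.half t) t.subterms
  | .dotminus s t => insert (.dotminus s t) (s.subterms ∪ t.subterms)

theorem finite_subterms (t : Term A) : t.subterms.Finite := by
  induction t with
  | atom a => exact Set.finite_singleton _
  | neg t ih => exact ih.insert _
  | half t ih => exact ih.insert _
  | dotminus s t ihs iht => exact (ihs.union iht).insert _

theorem self_mem_subterms (t : Term A) : t ∈ t.subterms := by
  cases t
  · exact Set.mem_singleton _
  all_goals exact Set.mem_insert _ _

/-- The truth value of a term under a valuation of the atoms. -/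
noncomputable def value (w : A → Set.Icc (0 : ℝ) 1) : Term A → Set.Icc (0 : ℝ) 1
  | .atom a => w a
  | .neg t => ⟨1 - t.value w, by linarith [(t.value w).2.2], by linarith [(t.value w).2.1]⟩
  | .half t => ⟨t.value w / 2, by linarith [(t.value w).2.1], by linarith [(t.value w).2.2]⟩
  | .dotminus s t => ⟨max (s.value w - t.value w) 0, le_max_right _ _,
      max_le (by linarith [(s.value w).2.2, (t.value w).2.1]) zero_le_one⟩

end Term

/-- Formulae of a free logic correspond to terms over the generators. -/
noncomputable def IsFreeOver.termEquiv {S₀ : Set S} (hS : IsFreeOver S₀) : Term S₀ ≃ S :=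
  Equiv.ofBijective Term.eval hS

theorem IsFreeOver.termEquiv_symm_eval {S₀ : Set S} (hS : IsFreeOver S₀) (t : Term S₀) :
    hS.termEquiv.symm t.eval = t :=
  hS.termEquiv.symm_apply_apply t

theorem IsFreeOver.eval_termEquiv_symm {S₀ : Set S} (hS : IsFreeOver S₀) (φ : S) :
    (hS.termEquiv.symm φ).eval = φ :=
  hS.termEquiv.apply_symm_apply φ

/-- The truth assignment extending a valuation of the free generators. -/
noncomputable def TruthAssignment.ofValuation {S₀ : Set S} (hS : IsFreeOver S₀)
    (w : S₀ → Set.Icc (0 : ℝ) 1) : TruthAssignment S where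
  val φ := (hS.termEquiv.symm φ).value w
  val_neg φ := by
    obtain ⟨t, rfl⟩ := hS.2 φ
    have h : neg t.eval = Term.eval (.neg t) := rfl
    rw [h, hS.termEquiv_symm_eval, hS.termEquiv_symm_eval]
    rfl
  val_half φ := by
    obtain ⟨t, rfl⟩ := hS.2 φ
    have h : half t.eval = Term.eval (.half t) := rfl
    rw [h, hS.termEquiv_symm_eval, hS.termEquiv_symm_eval]
    rfl
  val_dotminus φ ψ := by
    obtain ⟨s, rfl⟩ := hS.2 φ
    obtain ⟨t, rfl⟩ := hS.2 ψ
    have h : s.eval ∸ t.eval = Term.eval (.dotminus s t) := rfl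
    rw [h, hS.termEquiv_symm_eval, hS.termEquiv_symm_eval, hS.termEquiv_symm_eval]
    rfl

/-! ### Soundness and completeness. -/

theorem Derives.entails {Γ : Set S} {φ : S} (h : Derives Γ φ) : Entails Γ φ := by
  intro v hv
  induction h with
  | premise h => exact hv _ h
  | logical h =>
    cases h <;>
      simp only [TruthAssignment.Models, conj, v.val_dotminus, v.val_neg, v.val_half]
    case a1 φ ψ =>
      have := (v.val φ).2.1
      have := (v.val ψ).2.1
      grind
    case a2 => grind
    case a3 => grind
    case a4 => grind
    case a5 φ =>
      have := (v.val φ).2.1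
      grind
    case a6 φ =>
      have := (v.val φ).2.1
      grind
  | @mp φ ψ _ _ h₁ h₂ =>
    simp only [TruthAssignment.Models, v.val_dotminus] at *
    have := (v.val ψ).2.1
    grind

/-- Truncation and the range of atoms are the only places where order enters, so monotonicity of `g`
on the classes of subterms, `0` and `1` suffices. -/
theorem Term.value_eq_of_valuation {S₀ : Set S} {L : Type*} [MVChain L] {m : S → L}
    (m_neg : ∀ φ, m (ContPropLogic.neg φ) = 1 - m φ)
    (m_half : ∀ φ, m φ - m (ContPropLogic.half φ) = m (ContPropLogic.half φ))
    (m_dotminus : ∀ φ ψ, m (φ ∸ ψ) = m φ - m ψ) {g : L → ℝ} (g_zero : g 0 = 0) (g_one : g 1 = 1)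
    (g_sub : ∀ a b, b ≤ a → g (a - b) = g a - g b) {F : Set L}
    (g_pos : ∀ a b, a ∈ F → b ∈ F → a < b → g a < g b) (h_one : 1 ∈ F) (h_zero : 0 ∈ F)
    {w : S₀ → Set.Icc (0 : ℝ) 1} (hw : ∀ P : S₀, 0 ≤ g (m P) → g (m P) ≤ 1 → (w P : ℝ) = g (m P))
    (t : Term S₀) (ht : ∀ s ∈ t.subterms, m s.eval ∈ F) : (t.value w : ℝ) = g (m t.eval) := by
  have g_le : ∀ a b, a ∈ F → b ∈ F → a ≤ b → g a ≤ g b := fun a b ha hb h =>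
    h.eq_or_lt.elim (fun h => (congrArg g h).le) fun h => (g_pos a b ha hb h).le
  induction t with
  | atom P =>
    have hP := ht _ (Term.self_mem_subterms _)
    exact hw P (g_zero ▸ g_le _ _ h_zero hP (MVAlgebra.zero_le _))
      (g_one ▸ g_le _ _ hP h_one (MVAlgebra.le_one _))
  | neg t ih =>
    change 1 - (t.value w : ℝ) = g (m (ContPropLogic.neg t.eval))
    rw [ih fun s hs => ht s (.inr hs), m_neg, g_sub _ _ (MVAlgebra.le_one _), g_one]
  | half t ih =>
    change (t.value w : ℝ) / 2 = g (m (ContPropLogic.half t.eval))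
    have h := m_half t.eval
    have hle : m (ContPropLogic.half t.eval) ≤ m t.eval := by
      rw [← h]
      exact MVAlgebra.sub_le_self _ _
    have h' := g_sub _ _ hle
    rw [h] at h'
    rw [ih fun s hs => ht s (.inr hs)]
    linarith
  | dotminus s t ihs iht =>
    change max ((s.value w : ℝ) - t.value w) 0 = g (m (s.eval ∸ t.eval))
    have hs := ht s (.inr (.inl s.self_mem_subterms))
    have ht' := ht t (.inr (.inr t.self_mem_subterms))
    rw [ihs fun r hr => ht r (.inr (.inl hr)), iht fun r hr => ht r (.inr (.inr hr)), m_dotminus]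
    rcases le_total (m t.eval) (m s.eval) with h | h
    · rw [g_sub _ _ h, max_eq_left (sub_nonneg.2 (g_le _ _ ht' hs h))]
    · rw [MVAlgebra.le_iff_sub_eq_zero.1 h, g_zero, max_eq_right (sub_nonpos.2 (g_le _ _ hs ht' h))]

theorem Entails.derives (hS : IsFree S) {Γ : Set S} (hΓ : Γ.Finite) {φ : S} (h : Entails Γ φ) :
    Derives Γ φ := by
  have : Nonempty S := ⟨φ⟩
  obtain ⟨S₀, hS₀⟩ := hS
  by_contra hφ
  obtain ⟨T, hΓT, hT⟩ := (Theory.deductiveClosure Γ).exists_maximal hφ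
  have hφT : φ ∉ T.carrier := by
    obtain ⟨-, -, h⟩ := hT.1
    exact h
  let _ : MVChain T.Lindenbaum := T.mvChain (Theory.total_of_maximal hT) hφT
  let F : Set T.Lindenbaum := insert 1 (insert 0
    ((fun t : Term S₀ => T.toLindenbaum t.eval) ''
      ⋃ ψ ∈ insert φ Γ, (hS₀.termEquiv.symm ψ).subterms))
  have hF : F.Finite := ((((hΓ.insert φ).biUnion fun ψ _ =>
    (hS₀.termEquiv.symm ψ).finite_subterms).image _).insert 0).insert 1
  -- Positivity on differences of elements of `F` yields strict monotonicity on `F`.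
  obtain ⟨g, g_zero, g_one, g_sub, g_pos⟩ :=
    MVChain.exists_real_valuation (hF.image2 (fun a b => a - b) hF)
  have g_lt : ∀ a b, a ∈ F → b ∈ F → a < b → g a < g b := fun a b ha hb hab => by
    have := g_pos (b - a) ⟨b, hb, a, ha, rfl⟩ (MVChain.sub_ne_zero_of_lt hab)
    rw [g_sub _ _ hab.le] at this
    exact sub_pos.1 this
  -- The projection changes nothing for atoms occurring in `Γ` or `φ`; it only supplies legal values
  -- for the others.
  let w : S₀ → Set.Icc (0 : ℝ) 1 := fun P => Set.projIcc 0 1 zero_le_one (g (T.toLindenbaum P))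
  have hmem : ∀ ψ ∈ insert φ Γ, ∀ s ∈ (hS₀.termEquiv.symm ψ).subterms,
      T.toLindenbaum s.eval ∈ F := fun ψ hψ s hs =>
    .inr (.inr ⟨s, Set.mem_biUnion hψ hs, rfl⟩)
  have hval : ∀ ψ ∈ insert φ Γ,
      ((TruthAssignment.ofValuation hS₀ w).val ψ : ℝ) = g (T.toLindenbaum ψ) := fun ψ hψ => by
    have h := Term.value_eq_of_valuation Theory.toLindenbaum_neg
      Theory.toLindenbaum_sub_half Theory.toLindenbaum_dotminus
      g_zero g_one g_sub g_lt (.inl rfl) (.inr (.inl rfl)) (w := w)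
      (fun P h₀ h₁ => by simp [w, Set.projIcc_of_mem zero_le_one ⟨h₀, h₁⟩])
      (hS₀.termEquiv.symm ψ) (hmem ψ hψ)
    rwa [hS₀.eval_termEquiv_symm] at h
  have hmodel := h (TruthAssignment.ofValuation hS₀ w) fun γ hγ => by
    rw [TruthAssignment.Models, hval γ (.inr hγ),
      Theory.toLindenbaum_eq_zero.2 (hΓT (show Derives Γ γ from .premise hγ)), g_zero]
  rw [TruthAssignment.Models, hval φ (.inl rfl)] at hmodel
  have hφF : T.toLindenbaum φ ∈ F := by
    have h := hmem φ (.inl rfl) _ (hS₀.termEquiv.symm φ).self_mem_subterms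
    rwa [hS₀.eval_termEquiv_symm] at h
  have hφ₀ : (0 : T.Lindenbaum) < T.toLindenbaum φ :=
    lt_of_le_of_ne (MVAlgebra.zero_le _) fun h => hφT (Theory.toLindenbaum_eq_zero.1 h.symm)
  have := g_lt _ _ (.inr (.inl rfl)) hφF hφ₀
  rw [g_zero, hmodel] at this
  exact lt_irrefl _ this

end ContPropLogic

theorem mainTheorem7 {S : Type*} [ContPropLogic S] (hS : ContPropLogic.IsFree S)
    (Γ : Set S) (hΓ : Γ.Finite) (φ : S) :
    ContPropLogic.Entails Γ φ ↔ ContPropLogic.Derives Γ φ :=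
  ⟨fun h => h.derives hS hΓ, fun h => h.entails⟩
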